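/- Conventions. For an integer $k\ge 1$ put $\log(k)=\lfloor\log_2 k\rfloor+1$ (the number of binary digits of $k$), and let $\log^*(n)$ be the number of times the binary logarithm $\log_2$ must be applied to $n$ until the result is at most $1$. Models. For $\ell\ge 1$ let $\Pi_\ell=\{p_1,\dots,p_\ell\}$. In a Kripke model over $\Pi_\ell$ (with non-empty domain) the identifier of a node $w$ is the $\ell$-bit string whose $i$th bit is $1$ iff $p_i$ holds at $w$. Let $\mathcal G(\ell,\Delta)$ be the class of finite Kripke models $(W,R,V)$ over $\Pi_\ell$ in which distinct nodes have distinct identifiers, every node has out-degree at most $\Delta$, and $R$ is symmetric and irreflexive. (In particular, for $\ell=\log(n)$ it contains every $n$-node graph of maximum degree at most $\Delta$ whose nodes carry the identifiers $1,\dots,n$ in binary.) The $i$th neighbour of $w$ is the $i$th element of $\{v : (w,v)\in R\}$ in the lexicographic order of the identifiers. Programs. A $(\Pi_\ell,\Delta)$-program of MPMSC has a finite non-empty linearly ordered set of schema variables (its heads) and, for each head $Y$, a terminal clause $Y(0):=\varphi$ and an iteration clause $Y:=_{\varphi_1,\dots,\varphi_m}\psi_1;\dots;\psi_m;\chi$ ($m\ge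 0$). The formulas are built from $\top$, propositions of $\Pi_\ell$, heads (not in terminal clauses), $\neg$, $\wedge$ and $\Diamond_1,\dots,\Diamond_\Delta$, where $\Diamond_i\varphi$ says that the $i$th neighbour exists and satisfies $\varphi$; $\varphi$ and the conditions $\varphi_k$ have modal depth $0$, and the $\psi_k$ and $\chi$ have modal depth at most $1$. In round $0$ the head $Y$ has at each node the truth value of the body of its terminal clause. In round $r+1$ it has at $w$ the truth value of $\psi_k$ for the first $k$ such that $\varphi_k$ is true at $w$, or of $\chi$ if there is no such $k$; all of these are evaluated with the values of the heads in round $r$. Round $r+1$ is a global communication round if, at some node, the $\psi_k$ or $\chi$ used by some clause in that round contains a diamond. Some heads are attention predicates and some are print predicates; both kinds are called appointed. In the first round in which some attention predicate is true at $w$, the node $w$ outputs the string of truth values of the print predicates at $w$ in that round. A program defines a $k$-colouring if on every model in $\mathcal G(\ell,\Delta)$ every node outputs, in some round, a string $0^a10^b$ with $0\le a\le k-1$ and $b\ge 0$; the colouring is proper if adjacent nodes always output different strings. The size of a program is the number of occurrences of proposition symbols, heads, and operators $\top,\neg,\wedge,\Diamond_i$ in its clauses. Lemma (Cole–Vishkin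 lemma). There is an absolute constant $C$ such that for all integers $n\ge 1$ and $\Delta\ge 1$ there is a $(\Pi_{\log(n)},\Delta)$-program of MPMSC whose attention predicates and print predicates coincide, which has exactly $7^\Delta$ appointed predicates, and which has the following properties. 1. It defines a proper $7^\Delta$-colouring. 2. Ignoring the appointed predicates (and their clauses), it has at most $C\,\Delta\log(n)$ heads and size at most $C\,\Delta^2\log(n)$. 3. If $n\ge 2$, then on every model in $\mathcal G(\log(n),\Delta)$ every node outputs in a round $r\le C\log(n)\,\log(\log(n))\,\log^*(n)$. 4. On every model in $\mathcal G(\log(n),\Delta)$ the whole run has exactly $\log^*(n)+4$ global communication rounds, and every node outputs in or after the last of them. -/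

import Mathlib

namespace MPMSC

/-! ### Kripke models with identifiers -/

/-- A Kripke model over the `ℓ` identifier propositions `p_1, …, p_ℓ`
(the symbol `p_{i+1}` is `i : Fin ℓ`). -/
structure KripkeModel (ℓ : ℕ) where
  /-- the domain -/
  W : Type
  nonempty : Nonempty W
  /-- the accessibility relation -/
  R : W → W → Prop
  /-- the valuation -/
  V : Fin ℓ → Set W

namespace KripkeModel

variable {ℓ : ℕ}

/-- The set of out-neighbours of a node. -/
def succ (M : KripkeModel ℓ) (w : M.W) : Set M.W := {v | M.R w v}

open Classical in
/-- The identifier of a node: the `ℓ`-bit string whose `i`-th bit tells whether `p_i` holds.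
Identifiers are ordered lexicographically, with `false < true`. -/
noncomputable def ident (M : KripkeModel ℓ) (w : M.W) : Lex (Fin ℓ → Bool) :=
  toLex fun i => decide (w ∈ M.V i)

/-- `v` is the `(i+1)`-st neighbour of `w`: an out-neighbour of `w` such that exactly `i`
out-neighbours of `w` have a smaller identifier. -/
def IsNeighbour (M : KripkeModel ℓ) (i : ℕ) (w v : M.W) : Prop :=
  v ∈ M.succ w ∧ {u | u ∈ M.succ w ∧ M.ident u < M.ident v}.ncard = i

/-- The class of finite Kripke models with (pairwise distinct) identifiers and with out-degree
at most `Δ`. -/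
def InClass (M : KripkeModel ℓ) (Δ : ℕ) : Prop :=
  Finite M.W ∧ Function.Injective M.ident ∧ ∀ w, (M.succ w).ncard ≤ Δ

/-- The models in the class above that are graphs: the edge relation is symmetric and
irreflexive. -/
def IsGraph (M : KripkeModel ℓ) (Δ : ℕ) : Prop :=
  M.InClass Δ ∧ (∀ w v, M.R w v → M.R v w) ∧ ∀ w, ¬ M.R w w

end KripkeModel

/-! ### Schemata -/

/-- Multimodal schemata over the propositions `p_1, …, p_ℓ`, the diamonds `◇_1, …, ◇_Δ`
(`◇_{i+1}` is `dia i`) and the schema variables in `X`. -/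
inductive Schema (ℓ Δ : ℕ) (X : Type) : Type
  | top : Schema ℓ Δ X
  | prop : Fin ℓ → Schema ℓ Δ X
  | var : X → Schema ℓ Δ X
  | neg : Schema ℓ Δ X → Schema ℓ Δ X
  | and : Schema ℓ Δ X → Schema ℓ Δ X → Schema ℓ Δ X
  | dia : Fin Δ → Schema ℓ Δ X → Schema ℓ Δ X

namespace Schema

variable {ℓ Δ : ℕ} {X : Type}

/-- The maximum nesting depth of diamonds. -/
def modalDepth : Schema ℓ Δ X → ℕ
  | top => 0
  | prop _ => 0
  | var _ => 0
  | neg φ => φ.modalDepth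
  | and φ ψ => max φ.modalDepth ψ.modalDepth
  | dia _ φ => φ.modalDepth + 1

/-- The number of occurrences of proposition symbols, schema variables and operators. -/
def length : Schema ℓ Δ X → ℕ
  | top => 1
  | prop _ => 1
  | var _ => 1
  | neg φ => φ.length + 1
  | and φ ψ => φ.length + ψ.length + 1
  | dia _ φ => φ.length + 1

/-- Truth of a schema at a node, where the schema variable `Y` is true at exactly the nodes `w`
with `g Y w`. -/
def Sat (M : KripkeModel ℓ) (g : X → M.W → Prop) : Schema ℓ Δ X → M.W → Prop
  | top, _ => True
  | prop i, w => w ∈ M.V i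
  | var Y, w => g Y w
  | neg φ, w => ¬ Sat M g φ w
  | and φ ψ, w => Sat M g φ w ∧ Sat M g ψ w
  | dia i φ, w => ∃ v, M.IsNeighbour i w v ∧ Sat M g φ v

end Schema

/-! ### Iteration clauses -/

/-- The right-hand side `φ_1, …, φ_m : ψ_1; …; ψ_m; χ` of an iteration clause. The list consists
of the pairs (condition `φ_k`, consequence `ψ_k`); the backup is `χ`. A standard clause with
body `χ` has the empty list of conditions. -/
structure Clause (ℓ Δ : ℕ) (X : Type) where
  branches : List (Schema ℓ Δ X × Schema ℓ Δ X)
  backup : Schema ℓ Δ X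

namespace Clause

variable {ℓ Δ : ℕ} {X : Type}

/-- The number of symbol occurrences in the right-hand side. -/
def length (c : Clause ℓ Δ X) : ℕ :=
  (c.branches.map fun b => b.1.length + b.2.length).sum + c.backup.length

open Classical in
/-- The schema used as the body of the clause at the node `w`: the consequence of the first
condition that is true at `w`, and the backup if no condition is true at `w`. -/
noncomputable def hotBody (c : Clause ℓ Δ X) (M : KripkeModel ℓ) (g : X → M.W → Prop)
    (w : M.W) : Schema ℓ Δ X :=
  ((c.branches.find? fun b => decide (b.1.Sat M g w)).map Prod.snd).getD c.backup

end Clause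

/-! ### Programs -/

/-- A program of message passing modal substitution calculus over `p_1, …, p_ℓ` with diamonds
`◇_1, …, ◇_Δ`, whose set of head predicates is the finite linearly ordered set `H` of schema
variables. -/
structure Program (ℓ Δ : ℕ) (H : Type) where
  nonempty : Nonempty H
  /-- the body of the terminal clause of a head predicate -/
  terminal : H → Schema ℓ Δ Empty
  /-- the iteration clause of a head predicate -/
  iteration : H → Clause ℓ Δ H
  /-- the attention predicates -/
  attention : Finset H
  /-- the print predicates -/
  print : Finset H
  terminal_depth : ∀ Y, (terminal Y).modalDepth = 0
  condition_depth : ∀ Y, ∀ b ∈ (iteration Y).branches, b.1.modalDepth = 0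
  consequence_depth : ∀ Y, ∀ b ∈ (iteration Y).branches, b.2.modalDepth ≤ 1
  backup_depth : ∀ Y, (iteration Y).backup.modalDepth ≤ 1

namespace Program

variable {ℓ Δ : ℕ} {H : Type}

/-- The global configuration of round `n`: `Λ.config M n Y w` says that the `n`-th iteration
formula of the head predicate `Y` is true at `w`. -/
noncomputable def config (Λ : Program ℓ Δ H) (M : KripkeModel ℓ) : ℕ → H → M.W → Prop
  | 0, Y, w => (Λ.terminal Y).Sat M (fun x _ => x.elim) w
  | n + 1, Y, w =>
      ((Λ.iteration Y).hotBody M (Λ.config M n) w).Sat M (Λ.config M n) w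

/-- The node `w` accepts in round `n`: some attention predicate is true there in round `n`, and
none is true there in an earlier round. -/
def AcceptsAt (Λ : Program ℓ Δ H) (M : KripkeModel ℓ) (w : M.W) (n : ℕ) : Prop :=
  (∃ Y ∈ Λ.attention, Λ.config M n Y w) ∧
    ∀ m < n, ∀ Y ∈ Λ.attention, ¬ Λ.config M m Y w

open Classical in
/-- The string of truth values of the print predicates, in the order of the schema variables. -/
noncomputable def printString [LinearOrder H] (Λ : Program ℓ Δ H) (M : KripkeModel ℓ)
    (w : M.W) (n : ℕ) : List Bool :=
  (Λ.print.sort (· ≤ ·)).map fun Y => decide (Λ.config M n Y w)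

/-- The node `w` outputs the string `p` in round `n`. -/
def OutputsAt [LinearOrder H] (Λ : Program ℓ Δ H) (M : KripkeModel ℓ) (w : M.W) (n : ℕ)
    (p : List Bool) : Prop :=
  Λ.AcceptsAt M w n ∧ p = Λ.printString M w n

/-- In every graph of the class, every node outputs a string `0^a 1 0^b` with `a ≤ k - 1`. -/
def DefinesColouring [LinearOrder H] (Λ : Program ℓ Δ H) (k : ℕ) : Prop :=
  ∀ M : KripkeModel ℓ, M.IsGraph Δ → ∀ w : M.W, ∃ n p, Λ.OutputsAt M w n p ∧
    ∃ a b : ℕ, a < k ∧ p = List.replicate a false ++ true :: List.replicate b false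

/-- The program defines a `k`-colouring in which adjacent nodes output different strings. -/
def DefinesProperColouring [LinearOrder H] (Λ : Program ℓ Δ H) (k : ℕ) : Prop :=
  Λ.DefinesColouring k ∧
    ∀ M : KripkeModel ℓ, M.IsGraph Δ → ∀ w v : M.W, M.R w v →
      ∀ m n p q, Λ.OutputsAt M w m p → Λ.OutputsAt M v n q → p ≠ q

/-- The set of global communication rounds `n ≥ 1`: at some node, the consequence or backup that
some clause uses in round `n` contains a diamond. (Which one is used in round `n` is decided
by the truth values of round `n - 1`.) -/
def commRounds (Λ : Program ℓ Δ H) (M : KripkeModel ℓ) : Set ℕ :=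
  {n | ∃ m, n = m + 1 ∧ ∃ (w : M.W) (Y : H),
    0 < ((Λ.iteration Y).hotBody M (Λ.config M m) w).modalDepth}

/-- The appointed predicates. -/
def appointed [DecidableEq H] (Λ : Program ℓ Δ H) : Finset H := Λ.attention ∪ Λ.print

/-- The number of head predicates that are not appointed. -/
def numHeads [Fintype H] [DecidableEq H] (Λ : Program ℓ Δ H) : ℕ := (Λ.appointedᶜ).card

/-- The number of occurrences of symbols in the terminal and iteration clauses of the head
predicates that are not appointed (in each clause, the head itself is one occurrence). -/
def size [Fintype H] [DecidableEq H] (Λ : Program ℓ Δ H) : ℕ :=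
  ∑ Y ∈ Λ.appointedᶜ, ((1 + (Λ.terminal Y).length) + (1 + (Λ.iteration Y).length))

end Program

/-- The number of binary digits of `k ≥ 1`, that is, `⌊log₂ k⌋ + 1`. -/
def bitLog (k : ℕ) : ℕ := Nat.log 2 k + 1

/-- The iterated logarithm `log* n`: how often the binary logarithm has to be applied to `n`
until the value is at most `1`. -/
noncomputable def logStar (n : ℕ) : ℕ := sInf {k : ℕ | (Real.logb 2)^[k] (n : ℝ) ≤ 1}

end MPMSC

/-!
Every edge of a graph of maximum degree at most `Δ` joins a node to its `i`-th neighbour for some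
`i ≤ Δ`. For a fixed `i`, the edges from the nodes to their `i`-th neighbours form a pseudoforest,
in which the `i`-th neighbour is the parent. Cole–Vishkin reduction, started from the identifiers,
colours all these pseudoforests in parallel, and the tuple of the `Δ` colours of a node is a proper
colouring of the graph.

A Cole–Vishkin step replaces a colour by the position of its first difference from the parent's
colour, together with the digit at that position. If a node and its parent find the same position,
then they have different digits there, so their new colours differ again. The step turns `b`-digit
colours into colours with about `log₂ b` digits, so along the steps the number of digits follows the
iterated logarithms of `n` up to an additive constant. After `logStar n + 2` steps at most three
digits are left, and every further step leaves the colours below `6`.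

The program compares all digits with the parent's digits in one communication round, and then finds
the first difference without communication: two registers are shifted by one digit per round, while
a counter records the position. A ring of `ℓ + 1` heads, exactly one of which is true at a time,
separates the steps.
-/

namespace MPMSC

/-! ### The iterated logarithm -/

theorem exists_iterate_logb_le_one {k : ℕ} {x : ℝ} (hx : x ≤ k + 1) :
    ∃ j ≤ k, (Real.logb 2)^[j] x ≤ 1 := by
  induction k generalizing x with
  | zero => exact ⟨0, le_rfl, by simpa using hx⟩
  | succ k ih =>
    rcases le_or_gt x 1 with h1 | h1
    · exact ⟨0, Nat.zero_le _, h1⟩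
    · have hpow : (k + 2 : ℝ) ≤ 2 ^ (k + 1) := by exact_mod_cast (k + 1).lt_two_pow_self
      have hlog : Real.logb 2 x ≤ (k : ℝ) + 1 := by
        rw [Real.logb_le_iff_le_rpow (by norm_num) (by linarith)]
        push_cast at hx
        exact_mod_cast (by linarith : x ≤ 2 ^ (k + 1))
      obtain ⟨j, hj, h⟩ := ih hlog
      exact ⟨j + 1, by omega, h⟩

theorem iterate_logb_logStar_le_one (n : ℕ) : (Real.logb 2)^[logStar n] n ≤ 1 := by
  obtain ⟨j, -, h⟩ := exists_iterate_logb_le_one (k := n) (x := n) (by linarith)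
  exact Nat.sInf_mem (s := {k : ℕ | (Real.logb 2)^[k] (n : ℝ) ≤ 1}) ⟨j, h⟩

theorem one_lt_iterate_logb {n k : ℕ} (h : k < logStar n) : 1 < (Real.logb 2)^[k] n :=
  not_le.1 fun hk => Nat.notMem_of_lt_sInf h hk

theorem bitLog_le_logb_add_one {n : ℕ} (hn : 1 ≤ n) : (bitLog n : ℝ) ≤ Real.logb 2 n + 1 := by
  have h := Nat.floor_le (Real.logb_nonneg one_lt_two (Nat.one_le_cast.2 hn))
  rw [← Nat.cast_two (R := ℝ), Real.natFloor_logb_natCast] at h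
  simpa [bitLog] using h

theorem clog_le_logb_add_one {b : ℕ} (hb : 1 ≤ b) : (Nat.clog 2 b : ℝ) ≤ Real.logb 2 b + 1 := by
  have h := Nat.ceil_lt_add_one (Real.logb_nonneg one_lt_two (Nat.one_le_cast.2 hb))
  rw [← Nat.cast_two (R := ℝ), Real.natCeil_logb_natCast] at h
  simpa using h.le

theorem one_le_logStar {n : ℕ} (hn : 2 ≤ n) : 1 ≤ logStar n := by
  by_contra! h
  have hle := iterate_logb_logStar_le_one n
  rw [Nat.lt_one_iff.1 h, Function.iterate_zero_apply] at hle
  exact absurd (Nat.cast_le_one.1 hle) (by omega)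

theorem lt_two_pow_bitLog (b : ℕ) : b < 2 ^ bitLog b :=
  Nat.lt_pow_succ_log_self one_lt_two b

theorem logStar_le_bitLog_add_one {n : ℕ} (hn : 1 ≤ n) : logStar n ≤ bitLog n + 1 := by
  have hlog : Real.logb 2 n ≤ bitLog n + 1 := by
    rw [Real.logb_le_iff_le_rpow one_lt_two (by exact_mod_cast hn)]
    exact_mod_cast (lt_two_pow_bitLog n).le.trans (Nat.pow_le_pow_right two_pos (by omega))
  obtain ⟨j, hj, h⟩ := exists_iterate_logb_le_one hlog
  have : logStar n ≤ j + 1 := Nat.sInf_le h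
  omega

theorem two_mul_le_two_pow (b : ℕ) : 2 * b ≤ 2 ^ b := by
  induction b with
  | zero => simp
  | succ b ih =>
    have := Nat.one_le_two_pow (n := b)
    rcases b with _ | b
    · simp
    · rw [pow_succ]; omega

theorem bitLog_le_self {b : ℕ} (hb : 1 ≤ b) : bitLog b ≤ b :=
  Nat.log_lt_of_lt_pow (by omega) Nat.lt_two_pow_self

theorem bitLog_sq_le {b : ℕ} (hb : 1 ≤ b) : bitLog b ^ 2 ≤ 4 * b := by
  have hpow (q : ℕ) : (q + 1) ^ 2 ≤ 4 * 2 ^ q := by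
    induction q with
    | zero => norm_num
    | succ q ih =>
      rcases Nat.lt_or_ge q 2 with h | h
      · interval_cases q <;> norm_num
      · rw [pow_succ 2 q]; nlinarith
  exact (hpow _).trans (Nat.mul_le_mul_left 4 (Nat.pow_log_le_self 2 (by omega)))

/-! ### The Cole–Vishkin step -/

/-- The Cole–Vishkin step: the new colour `2 * j + b` records the first position `j` at which the
binary digits of the old colour `a` and of the parent's colour `p` differ, and the digit `b` of `a`
at that position. The value `0` at `a = p` is what a root keeps that compares the colour `0` with
a missing parent, which counts as having colour `0`. -/
noncomputable def cvStep (a p : ℕ) : ℕ :=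
  if a = p then 0 else
    2 * PiNat.firstDiff a.testBit p.testBit +
      (a.testBit (PiNat.firstDiff a.testBit p.testBit)).toNat

@[simp]
theorem cvStep_self (a : ℕ) : cvStep a a = 0 := if_pos rfl

theorem testBit_firstDiff_ne {a p : ℕ} (h : a ≠ p) :
    a.testBit (PiNat.firstDiff a.testBit p.testBit) ≠
      p.testBit (PiNat.firstDiff a.testBit p.testBit) :=
  PiNat.apply_firstDiff_ne fun he => h (Nat.eq_of_testBit_eq (congrFun he))

theorem firstDiff_testBit_lt {a p b : ℕ} (h : a ≠ p) (ha : a < 2 ^ b) (hp : p < 2 ^ b) :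
    PiNat.firstDiff a.testBit p.testBit < b := by
  by_contra! hb
  have hpow := Nat.pow_le_pow_right two_pos hb
  exact testBit_firstDiff_ne h (by
    rw [Nat.testBit_lt_two_pow (ha.trans_le hpow), Nat.testBit_lt_two_pow (hp.trans_le hpow)])

theorem cvStep_lt {a p b : ℕ} (ha : a < 2 ^ b) (hp : p < 2 ^ b) (hb : 1 ≤ b) :
    cvStep a p < 2 * b := by
  unfold cvStep
  split_ifs with h
  · omega
  · have := firstDiff_testBit_lt h ha hp
    have := (a.testBit (PiNat.firstDiff a.testBit p.testBit)).toNat_lt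
    omega

theorem exists_cvStep_eq {a p : ℕ} (h : a = p → a = 0) :
    ∃ j, cvStep a p = 2 * j + (a.testBit j).toNat := by
  unfold cvStep
  split_ifs with hap
  · exact ⟨0, by simp [h hap]⟩
  · exact ⟨_, rfl⟩

theorem cvStep_ne {a p q : ℕ} (h : a ≠ p) (hp : p = q → p = 0) : cvStep a p ≠ cvStep p q := by
  obtain ⟨k, hk⟩ := exists_cvStep_eq hp
  intro he
  rw [hk, cvStep, if_neg h] at he
  have hdiff := testBit_firstDiff_ne h
  generalize PiNat.firstDiff a.testBit p.testBit = j at he hdiff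
  have haj := (a.testBit j).toNat_lt
  have hpk := (p.testBit k).toNat_lt
  obtain rfl : j = k := by omega
  exact hdiff (Bool.eq_iff_iff.2 (by rw [← Bool.toNat_eq_one, ← Bool.toNat_eq_one]; omega))

/-- The three registers of a node that runs through the digits of its colour: the digits of the
colour and of the difference to the parent's colour that are still to be read, and the number
of digits read so far. -/
@[ext]
structure ScanState where
  colour : ℕ
  diff : ℕ
  pos : ℕ

namespace ScanState

/-- One scanning round: the current digit is dropped unless it is the first difference, at which
the scan stays forever. -/
def next (s : ScanState) : ScanState :=
  if s.diff.testBit 0 then s else ⟨s.colour / 2, s.diff / 2, s.pos + 1⟩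

/-- The new colour that a scan has found, and `0` as long as it has found no difference. -/
def readOut (s : ScanState) : ℕ :=
  if s.diff.testBit 0 then 2 * s.pos + (s.colour.testBit 0).toNat else 0

theorem iterate_next_of_testBit_eq_false (a d : ℕ) {r : ℕ} (h : ∀ i < r, d.testBit i = false) :
    next^[r] ⟨a, d, 0⟩ = ⟨a >>> r, d >>> r, r⟩ := by
  induction r with
  | zero => simp
  | succ r ih =>
    rw [Function.iterate_succ_apply', ih fun i hi => h i (by omega), next, if_neg]
    · simp only [Nat.shiftRight_succ]
    · simp [h r (by omega)]

theorem pos_iterate_next_le (s : ScanState) (r : ℕ) : (next^[r] s).pos ≤ s.pos + r := by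
  induction r with
  | zero => simp
  | succ r ih =>
    rw [Function.iterate_succ_apply', next]
    split_ifs
    · omega
    · simp only; omega

theorem readOut_iterate_next {a p r : ℕ} (ha : a < 2 ^ (r + 1)) (hp : p < 2 ^ (r + 1)) :
    (next^[r] ⟨a, a ^^^ p, 0⟩).readOut = cvStep a p := by
  rcases eq_or_ne a p with rfl | h
  · simp [iterate_next_of_testBit_eq_false, readOut]
  · set j := PiNat.firstDiff a.testBit p.testBit with hj
    have hlt : j < r + 1 := firstDiff_testBit_lt h ha hp
    have hreach : next^[j] ⟨a, a ^^^ p, 0⟩ = ⟨a >>> j, (a ^^^ p) >>> j, j⟩ :=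
      iterate_next_of_testBit_eq_false _ _ fun i hi => by
        simp [PiNat.apply_eq_of_lt_firstDiff hi]
    have hdiff : ((a ^^^ p) >>> j).testBit 0 = true := by
      simpa [Nat.testBit_shiftRight] using testBit_firstDiff_ne h
    rw [show r = (r - j) + j by omega, Function.iterate_add_apply, hreach,
      Function.iterate_fixed (by simp [next, hdiff]), readOut, if_pos hdiff, cvStep, if_neg h, ← hj]
    simp

end ScanState

theorem testBit_add_one_iff (t k : ℕ) :
    (t + 1).testBit k = true ↔ ¬ (t.testBit k = true ↔ ∀ j < k, t.testBit j = true) := by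
  induction k generalizing t with
  | zero => simp [Nat.testBit_zero]; omega
  | succ k ih =>
    rw [Nat.forall_lt_succ_left]
    simp only [Nat.testBit_succ, Nat.testBit_zero, decide_eq_true_eq]
    rcases Nat.mod_two_eq_zero_or_one t with h | h
    · rw [show (t + 1) / 2 = t / 2 by omega]
      simp [h]
    · rw [show (t + 1) / 2 = t / 2 + 1 by omega, ih]
      simp [h]

/-- A number of binary digits that suffices for the colours after `s` Cole–Vishkin steps that start
from colours with `ℓ` digits. -/
def bitBound (ℓ : ℕ) : ℕ → ℕ
  | 0 => ℓ
  | s + 1 => Nat.clog 2 (bitBound ℓ s) + 1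

theorem one_le_bitBound {ℓ : ℕ} (hℓ : 1 ≤ ℓ) : ∀ s, 1 ≤ bitBound ℓ s
  | 0 => hℓ
  | _ + 1 => Nat.succ_pos _

theorem bitBound_succ_le {ℓ s b d : ℕ} (h : bitBound ℓ s ≤ b) (hbd : b ≤ 2 ^ d) :
    bitBound ℓ (s + 1) ≤ d + 1 :=
  Nat.succ_le_succ (Nat.clog_le_of_le_pow (h.trans hbd))

theorem bitBound_bitLog_le {n s : ℕ} (hn : 1 ≤ n) (hs : s < logStar n) :
    (bitBound (bitLog n) s : ℝ) ≤ (Real.logb 2)^[s + 1] n + 5 := by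
  induction s with
  | zero =>
    have := bitLog_le_logb_add_one hn
    rw [bitBound, Function.iterate_one]
    linarith
  | succ s ih =>
    have hx := one_lt_iterate_logb hs
    have ih := ih (by omega)
    rw [Function.iterate_succ_apply']
    generalize (Real.logb 2)^[s + 1] (n : ℝ) = x at hx ih ⊢
    have hb : 1 ≤ bitBound (bitLog n) s := one_le_bitBound (Nat.succ_pos _) s
    have hclog := clog_le_logb_add_one hb
    have hlog : Real.logb 2 (bitBound (bitLog n) s) ≤ Real.logb 2 (2 ^ 3 * x) :=
      Real.logb_le_logb_of_le one_lt_two (by exact_mod_cast hb) (by linarith)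
    rw [Real.logb_mul (by norm_num) (by linarith), Real.logb_pow,
      Real.logb_self_eq_one one_lt_two] at hlog
    norm_num at hlog
    simp only [bitBound]
    push_cast
    linarith

theorem exists_bitBound_bitLog_le_six {n : ℕ} (hn : 1 ≤ n) :
    ∃ s ≤ logStar n, bitBound (bitLog n) s ≤ 6 := by
  have hle := iterate_logb_logStar_le_one n
  rcases h : logStar n with _ | s
  · rw [h, Function.iterate_zero_apply] at hle
    obtain rfl : n = 1 := le_antisymm (Nat.cast_le_one.1 hle) hn
    exact ⟨0, le_rfl, by simp [bitBound, bitLog]⟩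
  · rw [h] at hle
    have := bitBound_bitLog_le hn (show s < logStar n by omega)
    exact ⟨s, by omega, by exact_mod_cast (by linarith : (bitBound (bitLog n) s : ℝ) ≤ 6)⟩

theorem bitBound_bitLog_le_three {n s : ℕ} (hn : 1 ≤ n) (hs : logStar n + 2 ≤ s) :
    bitBound (bitLog n) s ≤ 3 := by
  obtain ⟨r, hr, h⟩ := exists_bitBound_bitLog_le_six hn
  replace hs : r + 2 ≤ s := by omega
  induction s, hs using Nat.le_induction with
  | base =>
    exact bitBound_succ_le (bitBound_succ_le h (d := 3) (by norm_num)) (d := 2) (by norm_num)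
  | succ s _ ih => exact bitBound_succ_le ih (d := 2) (by norm_num)

/-! ### Neighbours and colours -/

namespace KripkeModel

variable {ℓ : ℕ} {M : KripkeModel ℓ}

theorem finite_of_injective_ident (hM : Function.Injective M.ident) : Finite M.W :=
  Finite.of_injective (fun w => ofLex (M.ident w)) hM

theorem ncard_smaller_lt {w v u : M.W} (hM : Function.Injective M.ident) (hv : v ∈ M.succ w)
    (hvu : M.ident v < M.ident u) :
    {x | x ∈ M.succ w ∧ M.ident x < M.ident v}.ncard <
      {x | x ∈ M.succ w ∧ M.ident x < M.ident u}.ncard := by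
  have := finite_of_injective_ident hM
  refine Set.ncard_lt_ncard ⟨fun x hx => ⟨hx.1, hx.2.trans hvu⟩, fun hsub => ?_⟩
  exact (hsub ⟨hv, hvu⟩).2.false

theorem IsNeighbour.unique {i : ℕ} {w v u : M.W} (hM : Function.Injective M.ident)
    (hv : M.IsNeighbour i w v) (hu : M.IsNeighbour i w u) : v = u := by
  by_contra hne
  rcases lt_or_gt_of_ne (hM.ne hne) with hlt | hlt
  · exact (ncard_smaller_lt hM hv.1 hlt).ne (hv.2.trans hu.2.symm)
  · exact (ncard_smaller_lt hM hu.1 hlt).ne (hu.2.trans hv.2.symm)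

theorem InClass.exists_isNeighbour {Δ : ℕ} (hM : M.InClass Δ) {w v : M.W} (h : M.R w v) :
    ∃ i < Δ, M.IsNeighbour i w v := by
  have := hM.1
  have hss : {u | u ∈ M.succ w ∧ M.ident u < M.ident v} ⊂ M.succ w :=
    (Set.ssubset_iff_of_subset fun _ hu => hu.1).2 ⟨v, h, fun hu => hu.2.false⟩
  exact ⟨_, (Set.ncard_lt_ncard hss).trans_le (hM.2.2 w), h, rfl⟩

open Classical in
/-- The value of `f` at the `(i+1)`-st neighbour of a node, and `0` if there is no such neighbour.
The choice matters only for models in which identifiers are not distinct. -/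
noncomputable def atNeighbour (M : KripkeModel ℓ) (i : ℕ) (f : M.W → ℕ) (w : M.W) : ℕ :=
  if h : ∃ v, M.IsNeighbour i w v then f h.choose else 0

theorem atNeighbour_eq {i : ℕ} {w v : M.W} (hM : Function.Injective M.ident)
    (h : M.IsNeighbour i w v) (f : M.W → ℕ) : M.atNeighbour i f w = f v := by
  have hex : ∃ u, M.IsNeighbour i w u := ⟨v, h⟩
  rw [atNeighbour, dif_pos hex, hex.choose_spec.unique hM h]

theorem atNeighbour_eq_zero {i : ℕ} {w : M.W} (h : ¬ ∃ v, M.IsNeighbour i w v) (f : M.W → ℕ) :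
    M.atNeighbour i f w = 0 :=
  dif_neg h

theorem atNeighbour_lt {f : M.W → ℕ} {b : ℕ} (hb : 0 < b) (hf : ∀ v, f v < b) (i : ℕ) (w : M.W) :
    M.atNeighbour i f w < b := by
  unfold atNeighbour
  split
  exacts [hf _, hb]

theorem exists_isNeighbour_testBit_iff (hM : Function.Injective M.ident) (i j : ℕ) (f : M.W → ℕ)
    (w : M.W) : (∃ v, M.IsNeighbour i w v ∧ (f v).testBit j = true) ↔
      (M.atNeighbour i f w).testBit j = true := by
  by_cases h : ∃ v, M.IsNeighbour i w v
  · obtain ⟨v, hv⟩ := h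
    rw [atNeighbour_eq hM hv]
    exact ⟨fun ⟨u, hu, hbit⟩ => hv.unique hM hu ▸ hbit, fun hbit => ⟨v, hv, hbit⟩⟩
  · rw [atNeighbour_eq_zero h, Nat.zero_testBit]
    exact iff_of_false (fun ⟨v, hv, _⟩ => h ⟨v, hv⟩) Bool.false_ne_true

open Classical in
/-- The colour of a node after `s` Cole–Vishkin steps on the pseudoforest in which the parent of a
node is its `(i+1)`-st neighbour. Initially it is the identifier, read as a number whose least
significant digit is the truth value of `p_1`. -/
noncomputable def colour (M : KripkeModel ℓ) (i : ℕ) : ℕ → M.W → ℕ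
  | 0, w => Nat.ofBits fun j : Fin ℓ => decide (w ∈ M.V j)
  | s + 1, w => cvStep (colour M i s w) (M.atNeighbour i (colour M i s) w)

theorem colour_zero_injective (hM : Function.Injective M.ident) (i : ℕ) :
    Function.Injective (M.colour i 0) := fun w v h => hM <| congrArg toLex <| funext fun j => by
  have hbit := congrArg (fun a => a.testBit j) h
  simpa [colour, Nat.testBit_ofBits_lt] using hbit

theorem colour_lt_two_pow_bitBound (hℓ : 1 ≤ ℓ) (i s : ℕ) (w : M.W) :
    M.colour i s w < 2 ^ bitBound ℓ s := by
  induction s generalizing w with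
  | zero => exact Nat.ofBits_lt_two_pow _
  | succ s ih =>
    refine (cvStep_lt (ih w) (atNeighbour_lt (by positivity) ih i w)
      (one_le_bitBound hℓ s)).trans_le ?_
    rw [bitBound, pow_succ']
    exact Nat.mul_le_mul_left 2 (Nat.le_pow_clog one_lt_two _)

theorem colour_succ_lt (hℓ : 1 ≤ ℓ) (i s : ℕ) (w : M.W) :
    M.colour i (s + 1) w < 2 * bitBound ℓ s :=
  cvStep_lt (colour_lt_two_pow_bitBound hℓ i s w)
    (atNeighbour_lt (by positivity) (colour_lt_two_pow_bitBound hℓ i s) i w) (one_le_bitBound hℓ s)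

theorem colour_ne {i : ℕ} {w v : M.W} (hM : Function.Injective M.ident) (hirr : ∀ w, ¬ M.R w w)
    (s : ℕ) (h : M.IsNeighbour i w v) : M.colour i s w ≠ M.colour i s v := by
  induction s generalizing w v with
  | zero =>
    refine (colour_zero_injective hM i).ne ?_
    rintro rfl
    exact hirr w h.1
  | succ s ih =>
    rw [colour, colour, atNeighbour_eq hM h]
    refine cvStep_ne (ih h) fun he => ?_
    by_cases hex : ∃ u, M.IsNeighbour i v u
    · obtain ⟨u, hu⟩ := hex
      rw [atNeighbour_eq hM hu] at he
      exact absurd he (ih hu)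
    · rw [he, atNeighbour_eq_zero hex]

end KripkeModel

/-! ### Schemata and programs -/

attribute [local simp] Schema.Sat Schema.modalDepth Schema.length

section Register

variable {X W : Type} {b : ℕ}

open Classical in
/-- The number that the schema variables `Y 0, …, Y (b - 1)` store at a node, least significant
digit first. -/
noncomputable def register (g : X → W → Prop) (Y : Fin b → X) (w : W) : ℕ :=
  Nat.ofBits fun j => decide (g (Y j) w)

variable {g : X → W → Prop} {Y : Fin b → X} {w : W}

theorem register_lt_two_pow : register g Y w < 2 ^ b :=
  Nat.ofBits_lt_two_pow _

theorem testBit_register {j : ℕ} :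
    (register g Y w).testBit j = true ↔ ∃ h : j < b, g (Y ⟨j, h⟩) w := by
  by_cases h : j < b
  · simp [register, Nat.testBit_ofBits_lt, h]
  · simp [register, Nat.testBit_ofBits_ge _ _ (not_lt.1 h), h]

theorem testBit_register_val {j : Fin b} : (register g Y w).testBit j = true ↔ g (Y j) w := by
  simp [testBit_register]

theorem register_eq_mod {n : ℕ} (h : ∀ j : Fin b, g (Y j) w ↔ n.testBit j = true) :
    register g Y w = n % 2 ^ b := by
  refine Nat.eq_of_testBit_eq fun j => Bool.eq_iff_iff.2 ?_
  simp [testBit_register, Nat.testBit_mod_two_pow, h]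

end Register

namespace Schema

variable {ℓ Δ b : ℕ} {X : Type}

/-- Falsity. -/
def bot : Schema ℓ Δ X := neg top

/-- Exclusive disjunction. -/
def lxor (φ ψ : Schema ℓ Δ X) : Schema ℓ Δ X := and (neg (and φ ψ)) (neg (and (neg φ) (neg ψ)))

/-- The conjunction of the schemata `φ 0, …, φ (k - 1)`. -/
def conj : {k : ℕ} → (Fin k → Schema ℓ Δ X) → Schema ℓ Δ X
  | 0, _ => top
  | _ + 1, φ => and (φ 0) (conj fun i => φ i.succ)

/-- The digit number `j` of the register `Y`; the digits beyond its width are false. -/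
def digit (Y : Fin b → X) (j : ℕ) : Schema ℓ Δ X :=
  if h : j < b then var (Y ⟨j, h⟩) else bot

/-- The schema saying that the register `Y` stores the number `x`. Numbers below `2 ^ x` and
`2 ^ b` are determined by their first `b + x` digits. -/
def hasValue (Y : Fin b → X) (x : ℕ) : Schema ℓ Δ X :=
  conj fun j : Fin (b + x) => if x.testBit j then digit Y j else neg (digit Y j)

section Sat

variable {M : KripkeModel ℓ} {g : X → M.W → Prop} {w : M.W}

@[simp]
theorem sat_bot : ¬ (bot : Schema ℓ Δ X).Sat M g w := by simp [bot]

@[simp]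
theorem sat_lxor {φ ψ : Schema ℓ Δ X} :
    (lxor φ ψ).Sat M g w ↔ ¬ (φ.Sat M g w ↔ ψ.Sat M g w) := by
  simp only [lxor, Sat]
  tauto

@[simp]
theorem sat_conj {k : ℕ} {φ : Fin k → Schema ℓ Δ X} :
    (conj φ).Sat M g w ↔ ∀ i, (φ i).Sat M g w := by
  induction k with
  | zero => simp [conj]
  | succ k ih => simp [conj, ih, Fin.forall_fin_succ]

@[simp]
theorem sat_digit {Y : Fin b → X} {j : ℕ} :
    (digit Y j : Schema ℓ Δ X).Sat M g w ↔ (register g Y w).testBit j = true := by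
  by_cases h : j < b <;> simp [digit, testBit_register, h]

@[simp]
theorem sat_hasValue {Y : Fin b → X} {x : ℕ} :
    (hasValue Y x : Schema ℓ Δ X).Sat M g w ↔ register g Y w = x := by
  have hdigit (j : ℕ) :
      (if x.testBit j then digit Y j else neg (digit Y j) : Schema ℓ Δ X).Sat M g w ↔
        (register g Y w).testBit j = x.testBit j := by
    split_ifs with h <;> simp [h]
  simp only [hasValue, sat_conj, hdigit]
  refine ⟨fun h => Nat.eq_of_testBit_eq fun j => ?_, fun h j => by rw [h]⟩
  rcases lt_or_ge j (b + x) with hj | hj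
  · exact h ⟨j, hj⟩
  · have hb := Nat.pow_le_pow_right two_pos (show b ≤ j by omega)
    have hx := Nat.pow_le_pow_right two_pos (show x ≤ j by omega)
    rw [Nat.testBit_lt_two_pow (register_lt_two_pow.trans_le hb),
      Nat.testBit_lt_two_pow (x.lt_two_pow_self.trans_le hx)]

end Sat

@[simp]
theorem modalDepth_bot : (bot : Schema ℓ Δ X).modalDepth = 0 := rfl

@[simp]
theorem modalDepth_lxor (φ ψ : Schema ℓ Δ X) :
    (lxor φ ψ).modalDepth = max φ.modalDepth ψ.modalDepth := by
  simp [lxor]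

theorem modalDepth_conj_eq_zero {k : ℕ} {φ : Fin k → Schema ℓ Δ X}
    (h : ∀ i, (φ i).modalDepth = 0) : (conj φ).modalDepth = 0 := by
  induction k with
  | zero => rfl
  | succ k ih => simp [conj, h, ih]

@[simp]
theorem modalDepth_digit (Y : Fin b → X) (j : ℕ) : (digit Y j : Schema ℓ Δ X).modalDepth = 0 := by
  unfold digit
  split_ifs <;> rfl

@[simp]
theorem modalDepth_hasValue (Y : Fin b → X) (x : ℕ) :
    (hasValue Y x : Schema ℓ Δ X).modalDepth = 0 :=
  modalDepth_conj_eq_zero fun j => by split_ifs <;> simp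

@[simp]
theorem length_lxor (φ ψ : Schema ℓ Δ X) :
    (lxor φ ψ).length = 2 * φ.length + 2 * ψ.length + 7 := by
  simp only [lxor, length]
  ring

theorem length_conj_le {k d : ℕ} {φ : Fin k → Schema ℓ Δ X} (h : ∀ i, (φ i).length ≤ d) :
    (conj φ).length ≤ k * (d + 1) + 1 := by
  induction k with
  | zero => simp [conj]
  | succ k ih =>
    have h0 := h 0
    have hsucc := ih fun i => h i.succ
    simp only [conj, length]
    rw [Nat.succ_mul]
    omega

theorem length_digit_le (Y : Fin b → X) (j : ℕ) : (digit Y j : Schema ℓ Δ X).length ≤ 2 := by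
  unfold digit
  split_ifs <;> simp [bot]

end Schema

namespace Clause

variable {ℓ Δ : ℕ} {X : Type} {M : KripkeModel ℓ} {g : X → M.W → Prop} {w : M.W}

@[simp]
theorem hotBody_nil (χ : Schema ℓ Δ X) : (Clause.mk [] χ).hotBody M g w = χ := rfl

open Classical in
@[simp]
theorem hotBody_cons (φ ψ : Schema ℓ Δ X) (bs : List (Schema ℓ Δ X × Schema ℓ Δ X))
    (χ : Schema ℓ Δ X) : (Clause.mk ((φ, ψ) :: bs) χ).hotBody M g w =
      if φ.Sat M g w then ψ else (Clause.mk bs χ).hotBody M g w := by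
  by_cases h : φ.Sat M g w <;> simp [hotBody, h]

end Clause

namespace Program

variable {ℓ Δ : ℕ} {H : Type}

theorem acceptsAt_iff_of_first {Λ : Program ℓ Δ H} {M : KripkeModel ℓ} {w : M.W} {r n : ℕ}
    (hr : ∃ Y ∈ Λ.attention, Λ.config M r Y w)
    (hlt : ∀ m < r, ∀ Y ∈ Λ.attention, ¬ Λ.config M m Y w) : Λ.AcceptsAt M w n ↔ n = r := by
  refine ⟨fun ⟨⟨Y, hY, hn⟩, hfirst⟩ => ?_, fun h => h ▸ ⟨hr, hlt⟩⟩
  rcases lt_trichotomy n r with h | h | h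
  · exact absurd hn (hlt n h Y hY)
  · exact h
  · obtain ⟨Z, hZ, hconfig⟩ := hr
    exact absurd hconfig (hfirst r h Z hZ)

variable [LinearOrder H]

/-- The program properly colours the model `M` with `k` colours: the two conditions in the
definition of a proper `k`-colouring, for a single model. -/
def ProperlyColours (Λ : Program ℓ Δ H) (M : KripkeModel ℓ) (k : ℕ) : Prop :=
  (∀ w, ∃ n p, Λ.OutputsAt M w n p ∧
    ∃ a b : ℕ, a < k ∧ p = List.replicate a false ++ true :: List.replicate b false) ∧
  ∀ w v, M.R w v → ∀ m n p q, Λ.OutputsAt M w m p → Λ.OutputsAt M v n q → p ≠ q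

theorem definesProperColouring_of_properlyColours {Λ : Program ℓ Δ H} {k : ℕ}
    (h : ∀ M : KripkeModel ℓ, M.IsGraph Δ → Λ.ProperlyColours M k) :
    Λ.DefinesProperColouring k :=
  ⟨fun M hM => (h M hM).1, fun M hM => (h M hM).2⟩

theorem exists_map_eq_replicate_append {α : Type*} {l : List α} (hl : l.Nodup) {x : α}
    (hx : x ∈ l) {f : α → Bool} (hf : ∀ y ∈ l, f y = true ↔ y = x) :
    ∃ a b, a < l.length ∧
      l.map f = List.replicate a false ++ true :: List.replicate b false := by
  obtain ⟨s, t, rfl⟩ := List.append_of_mem hx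
  have hfalse {u : List α} (hu : u ⊆ s ++ x :: t) (hxu : x ∉ u) :
      u.map f = List.replicate u.length false :=
    List.map_eq_replicate_iff.2 fun y hy => by
      simpa using mt (hf y (hu hy)).1 (ne_of_mem_of_not_mem hy hxu)
  have hxs : x ∉ s := fun h => (List.disjoint_of_nodup_append hl) h List.mem_cons_self
  have hxt : x ∉ t := (List.nodup_cons.1 (List.nodup_append.1 hl).2.1).1
  refine ⟨s.length, t.length, by simp, ?_⟩
  rw [List.map_append, List.map_cons, (hf x hx).2 rfl, hfalse (by simp) hxs, hfalse (by simp) hxt]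

theorem properlyColours_of_unique {Λ : Program ℓ Δ H} {M : KripkeModel ℓ} {r : ℕ} {Y : M.W → H}
    (hacc : ∀ w n, Λ.AcceptsAt M w n ↔ n = r) (hY : ∀ w, Y w ∈ Λ.print)
    (hconfig : ∀ w, ∀ Z ∈ Λ.print, Λ.config M r Z w ↔ Z = Y w)
    (hne : ∀ w v, M.R w v → Y w ≠ Y v) : Λ.ProperlyColours M Λ.print.card := by
  constructor
  · intro w
    refine ⟨r, _, ⟨(hacc w r).2 rfl, rfl⟩, ?_⟩
    rw [← Λ.print.length_sort (· ≤ ·)]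
    exact exists_map_eq_replicate_append (Λ.print.sort_nodup _) ((Λ.print.mem_sort _).2 (hY w))
      fun Z hZ => by simpa using hconfig w Z ((Λ.print.mem_sort _).1 hZ)
  · rintro w v hwv m n p p' ⟨hm, rfl⟩ ⟨hn, rfl⟩ he
    obtain rfl := (hacc w m).1 hm
    obtain rfl := (hacc v n).1 hn
    have hbit := List.map_inj_left.1 he (Y w) ((Λ.print.mem_sort _).2 (hY w))
    have hiff := decide_eq_decide.1 hbit
    rw [hconfig w _ (hY w), hconfig v _ (hY w)] at hiff
    exact hne w v hwv (hiff.1 rfl)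

end Program

/-! ### The Cole–Vishkin program -/

/-- The heads of a program that runs the Cole–Vishkin colour reduction for all `Δ` pseudoforests in
parallel, in `q + 1` phases of `ℓ + 1` rounds. The final colours are numbers below `c`. -/
inductive CVHead (ℓ Δ q c : ℕ) : Type
  /-- the round number is congruent to `j` -/
  | tok (j : ZMod (ℓ + 1))
  /-- more than `b` phases are completed -/
  | ph (b : Fin (q + 1))
  /-- the digits of the colour in the `i`-th pseudoforest that are still to be read -/
  | col (i : Fin Δ) (j : Fin ℓ)
  /-- the digits in which this colour differs from the parent's colour -/
  | diff (i : Fin Δ) (j : Fin ℓ)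
  /-- the number of digits that have been read, in binary -/
  | cnt (i : Fin Δ) (k : Fin (bitLog ℓ))
  /-- the final colour in the `i`-th pseudoforest is `f i`; the appointed heads -/
  | out (f : Fin Δ → Fin c)

namespace CVHead

variable {ℓ Δ q c : ℕ}

/-- The heads as a sum of standard finite types. -/
def sumEquiv : CVHead ℓ Δ q c ≃ ZMod (ℓ + 1) ⊕ Fin (q + 1) ⊕ (Fin Δ × Fin ℓ) ⊕ (Fin Δ × Fin ℓ) ⊕
    (Fin Δ × Fin (bitLog ℓ)) ⊕ (Fin Δ → Fin c) where
  toFun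
    | tok j => .inl j
    | ph b => .inr (.inl b)
    | col i j => .inr (.inr (.inl (i, j)))
    | diff i j => .inr (.inr (.inr (.inl (i, j))))
    | cnt i k => .inr (.inr (.inr (.inr (.inl (i, k)))))
    | out f => .inr (.inr (.inr (.inr (.inr f))))
  invFun
    | .inl j => tok j
    | .inr (.inl b) => ph b
    | .inr (.inr (.inl (i, j))) => col i j
    | .inr (.inr (.inr (.inl (i, j)))) => diff i j
    | .inr (.inr (.inr (.inr (.inl (i, k))))) => cnt i k
    | .inr (.inr (.inr (.inr (.inr f)))) => out f
  left_inv := by rintro (_ | _ | _ | _ | _ | _) <;> rfl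
  right_inv := by rintro (_ | _ | _ | _ | _ | _) <;> rfl

instance : Fintype (CVHead ℓ Δ q c) := .ofEquiv _ sumEquiv.symm

noncomputable instance : LinearOrder (CVHead ℓ Δ q c) :=
  LinearOrder.lift' (Fintype.equivFin _) (Fintype.equivFin _).injective

/-- The heads that carry the output. -/
def outs : Finset (CVHead ℓ Δ q c) := Finset.univ.map ⟨out, fun _ _ => out.inj⟩

@[simp]
theorem mem_outs {Y : CVHead ℓ Δ q c} : Y ∈ outs ↔ ∃ f, out f = Y :=
  Finset.mem_map.trans (by simp only [Finset.mem_univ, true_and]; rfl)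

theorem card_outs : (outs : Finset (CVHead ℓ Δ q c)).card = c ^ Δ := by simp [outs]

theorem sum_compl_outs (f : CVHead ℓ Δ q c → ℕ) :
    ∑ Y ∈ outsᶜ, f Y = (∑ j, f (tok j)) + ((∑ b, f (ph b)) + ((∑ i, ∑ j, f (col i j)) +
      ((∑ i, ∑ j, f (diff i j)) + ∑ i, ∑ k, f (cnt i k)))) := by
  have hite : ∑ Y ∈ outsᶜ, f Y = ∑ Y, if Y ∈ outs then 0 else f Y := by
    rw [Finset.compl_eq_univ_sdiff, ← Finset.filter_notMem_eq_sdiff, Finset.sum_filter]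
    exact Finset.sum_congr rfl fun Y _ => by split_ifs <;> simp_all
  rw [hite, ← sumEquiv.symm.sum_comp]
  simp [sumEquiv, Fintype.sum_sum_type, Fintype.sum_prod_type]

end CVHead

open CVHead Schema

variable {ℓ Δ q c : ℕ}

section Clauses

/-- The schema saying that all phases are completed. -/
def allDone : Schema ℓ Δ (CVHead ℓ Δ q c) := var (ph (Fin.last q))

/-- The digit number `j` of the colour that the scan has found: the digit of the old colour at the
first difference, followed by the digits of the position of that difference. -/
def foundDigit (i : Fin Δ) : ℕ → Schema ℓ Δ (CVHead ℓ Δ q c)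
  | 0 => digit (col i) 0
  | k + 1 => digit (cnt i) k

/-- The terminal clauses: the first phase starts, and the colours are the identifiers. -/
def cvTerminal : CVHead ℓ Δ q c → Schema ℓ Δ Empty
  | tok j => if j = 0 then top else bot
  | col _ j => prop j
  | _ => bot

/-- The iteration clauses. In the first round of a phase (`tok 0`) the colours are compared with the
parents' colours; in the last one (`tok (-1)`) the new colours are stored. In between the registers
`col i` and `diff i` are shifted by one digit per round until `diff i` starts with a difference. -/
def cvClause : CVHead ℓ Δ q c → Clause ℓ Δ (CVHead ℓ Δ q c)
  | tok j => ⟨[], var (tok (j - 1))⟩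
  | ph b => ⟨[(var (tok (-1)), Fin.cases top (fun b' => var (ph b'.castSucc)) b)], var (ph b)⟩
  | col i j => ⟨[(var (tok (-1)), and (digit (diff i) 0) (foundDigit i j)),
      (var (tok 0), var (col i j)), (digit (diff i) 0, var (col i j))], digit (col i) (j + 1)⟩
  | diff i j => ⟨[(and (var (tok 0)) (neg allDone), lxor (var (col i j)) (dia i (var (col i j)))),
      (digit (diff i) 0, var (diff i j))], digit (diff i) (j + 1)⟩
  | cnt i k => ⟨[(var (tok 0), bot), (digit (diff i) 0, var (cnt i k))],
      lxor (var (cnt i k)) (conj fun j : Fin k => digit (cnt i) j)⟩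
  | out f => ⟨[], and allDone (conj fun i => hasValue (col i) (f i))⟩

@[simp]
theorem modalDepth_foundDigit (i : Fin Δ) (j : ℕ) :
    (foundDigit i j : Schema ℓ Δ (CVHead ℓ Δ q c)).modalDepth = 0 := by
  cases j <;> simp [foundDigit]

@[simp]
theorem modalDepth_allDone :
    (allDone : Schema ℓ Δ (CVHead ℓ Δ q c)).modalDepth = 0 := rfl

@[simp]
theorem sat_foundDigit {M : KripkeModel ℓ} {g : CVHead ℓ Δ q c → M.W → Prop} {w : M.W} {i : Fin Δ}
    {j : ℕ} : (foundDigit i j).Sat M g w ↔ (2 * register g (cnt i) w +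
      ((register g (col i) w).testBit 0).toNat).testBit j = true := by
  rw [← Nat.bit_val]
  cases j <;> simp only [foundDigit, sat_digit, Nat.testBit_bit_zero, Nat.testBit_bit_succ]

theorem length_foundDigit_le (i : Fin Δ) (j : ℕ) :
    (foundDigit i j : Schema ℓ Δ (CVHead ℓ Δ q c)).length ≤ 2 := by
  cases j <;> simp [foundDigit, length_digit_le]

end Clauses

variable (ℓ Δ q c) in
/-- The program that runs `q + 1` Cole–Vishkin steps in each of the `Δ` pseudoforests. -/
def cvProgram : Program ℓ Δ (CVHead ℓ Δ q c) where
  nonempty := ⟨tok 0⟩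
  terminal := cvTerminal
  iteration := cvClause
  attention := outs
  print := outs
  terminal_depth Y := by
    rcases Y with j | _ | _ | _ | _ | _
    · rw [cvTerminal]; split_ifs <;> rfl
    all_goals rfl
  condition_depth Y := by cases Y <;> simp [cvClause]
  consequence_depth Y := by
    rcases Y with _ | b | _ | _ | _ | _
    case ph => cases b using Fin.cases <;> simp [cvClause]
    all_goals simp [cvClause]
  backup_depth Y := by cases Y <;> simp [cvClause, modalDepth_conj_eq_zero]

/-! ### The run of the Cole–Vishkin program -/

section Run

variable {M : KripkeModel ℓ} {t : ℕ} {w : M.W}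

theorem config_zero (Y : CVHead ℓ Δ q c) :
    (cvProgram ℓ Δ q c).config M 0 Y w ↔ (cvTerminal Y).Sat M (fun x _ => x.elim) w :=
  Iff.rfl

theorem config_succ (Y : CVHead ℓ Δ q c) :
    (cvProgram ℓ Δ q c).config M (t + 1) Y w ↔
      ((cvClause Y).hotBody M ((cvProgram ℓ Δ q c).config M t) w).Sat M
        ((cvProgram ℓ Δ q c).config M t) w :=
  Iff.rfl

theorem config_tok {j : ZMod (ℓ + 1)} :
    (cvProgram ℓ Δ q c).config M t (tok j) w ↔ (t : ZMod (ℓ + 1)) = j := by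
  induction t generalizing j with
  | zero => by_cases h : j = 0 <;> simp [config_zero, cvTerminal, h, eq_comm]
  | succ t ih =>
    simp only [config_succ, cvClause, Clause.hotBody_nil, Sat]
    rw [ih, Nat.cast_succ, eq_sub_iff_add_eq]

theorem config_tok_zero : (cvProgram ℓ Δ q c).config M t (tok 0) w ↔ ℓ + 1 ∣ t := by
  rw [config_tok, ZMod.natCast_eq_zero_iff]

theorem config_tok_neg_one : (cvProgram ℓ Δ q c).config M t (tok (-1)) w ↔ ℓ + 1 ∣ t + 1 := by
  rw [config_tok, eq_neg_iff_add_eq_zero, ← Nat.cast_succ, ZMod.natCast_eq_zero_iff]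

theorem config_ph {b : Fin (q + 1)} :
    (cvProgram ℓ Δ q c).config M t (ph b) w ↔ b < t / (ℓ + 1) := by
  induction t generalizing b with
  | zero => simp [config_zero, cvTerminal]
  | succ t ih =>
    simp only [config_succ, cvClause, Clause.hotBody_cons, Clause.hotBody_nil, Sat,
      config_tok_neg_one, Nat.succ_div]
    split_ifs
    · cases b using Fin.cases <;> simp [ih]
    · simp [ih]

theorem sat_allDone :
    (allDone : Schema ℓ Δ _).Sat M ((cvProgram ℓ Δ q c).config M t) w ↔
      (q + 1) * (ℓ + 1) ≤ t := by
  rw [allDone, Sat, config_ph, Fin.val_last, Nat.lt_iff_add_one_le,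
    Nat.le_div_iff_mul_le ℓ.succ_pos]

variable (q c M t w) in
/-- The contents of the registers of a node in round `t`, for the pseudoforest number `i`. -/
noncomputable def registers (i : Fin Δ) : ScanState where
  colour := register ((cvProgram ℓ Δ q c).config M t) (col i) w
  diff := register ((cvProgram ℓ Δ q c).config M t) (diff i) w
  pos := register ((cvProgram ℓ Δ q c).config M t) (cnt i) w

theorem registers_colour_lt (i : Fin Δ) : (registers q c M t w i).colour < 2 ^ ℓ :=
  register_lt_two_pow

theorem registers_compare (hM : Function.Injective M.ident) (hℓ : 1 ≤ ℓ) (ht : ℓ + 1 ∣ t)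
    (hdone : t < (q + 1) * (ℓ + 1)) (i : Fin Δ) :
    registers q c M (t + 1) w i = ⟨(registers q c M t w i).colour,
      (registers q c M t w i).colour ^^^
        M.atNeighbour i (fun v => (registers q c M t v i).colour) w, 0⟩ := by
  have hload : ¬ ℓ + 1 ∣ t + 1 := fun h => by
    have := Nat.le_of_dvd one_pos ((Nat.dvd_add_right ht).1 h)
    omega
  have hnbr : M.atNeighbour i (fun v => (registers q c M t v i).colour) w < 2 ^ ℓ :=
    KripkeModel.atNeighbour_lt (by positivity) (fun _ => registers_colour_lt i) i w
  have hcol (j : Fin ℓ) (v : M.W) : (cvProgram ℓ Δ q c).config M t (col i j) v ↔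
      (registers q c M t v i).colour.testBit j = true := testBit_register_val.symm
  ext
  · refine (register_eq_mod fun j => ?_).trans (Nat.mod_eq_of_lt (registers_colour_lt i))
    simp [config_succ, cvClause, config_tok_zero, config_tok_neg_one, ht, hload, hcol]
  · refine (register_eq_mod fun j => ?_).trans
      (Nat.mod_eq_of_lt (Nat.xor_lt_two_pow (registers_colour_lt i) hnbr))
    simp [config_succ, cvClause, config_tok_zero, sat_allDone, ht, hdone, hcol,
      KripkeModel.exists_isNeighbour_testBit_iff hM i j fun v => (registers q c M t v i).colour]
  · refine (register_eq_mod fun j => ?_).trans (Nat.zero_mod _)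
    simp [config_succ, cvClause, config_tok_zero, ht]

theorem registers_scan {i : Fin Δ} (ht : ¬ ℓ + 1 ∣ t) (ht' : ¬ ℓ + 1 ∣ t + 1)
    (hpos : (registers q c M t w i).pos + 1 < 2 ^ bitLog ℓ) :
    registers q c M (t + 1) w i = (registers q c M t w i).next := by
  have hclause (Y : CVHead ℓ Δ q c) := config_succ (M := M) (t := t) (w := w) Y
  rw [ScanState.next]
  split_ifs with h
  · have h0 : (register ((cvProgram ℓ Δ q c).config M t) (diff i) w).testBit 0 = true := h
    ext <;> refine (register_eq_mod fun j => ?_).trans (Nat.mod_eq_of_lt register_lt_two_pow) <;>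
      simp [hclause, cvClause, config_tok_zero, config_tok_neg_one, ht, ht', h0,
        testBit_register_val, registers]
  · have h0 : ¬ (register ((cvProgram ℓ Δ q c).config M t) (diff i) w).testBit 0 = true := h
    ext
    · refine (register_eq_mod fun j => ?_).trans
        (Nat.mod_eq_of_lt ((Nat.div_le_self _ 2).trans_lt register_lt_two_pow))
      simp [hclause, cvClause, config_tok_zero, config_tok_neg_one, ht, ht', h0,
        Nat.testBit_div_two, registers]
    · refine (register_eq_mod fun j => ?_).trans
        (Nat.mod_eq_of_lt ((Nat.div_le_self _ 2).trans_lt register_lt_two_pow))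
      simp [hclause, cvClause, config_tok_zero, ht, h0, Nat.testBit_div_two, registers]
    · refine (register_eq_mod fun k => ?_).trans (Nat.mod_eq_of_lt hpos)
      simp [hclause, cvClause, config_tok_zero, ht, h0, testBit_add_one_iff, registers,
        Fin.forall_iff, testBit_register_val]

theorem registers_load {i : Fin Δ} (ht : ℓ + 1 ∣ t + 1) :
    (registers q c M (t + 1) w i).colour = (registers q c M t w i).readOut % 2 ^ ℓ := by
  refine register_eq_mod fun j => ?_
  by_cases h : (register ((cvProgram ℓ Δ q c).config M t) (diff i) w).testBit 0 = true <;>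
    simp [config_succ, cvClause, config_tok_neg_one, ht, ScanState.readOut, registers, h]

theorem registers_iterate_scan {i : Fin Δ} (ht : ℓ + 1 ∣ t)
    (hpos : (registers q c M (t + 1) w i).pos = 0) {r : ℕ} (hr : r < ℓ) :
    registers q c M (t + 1 + r) w i = ScanState.next^[r] (registers q c M (t + 1) w i) := by
  induction r with
  | zero => rfl
  | succ r ih =>
    have ih := ih (by omega)
    have hle := ScanState.pos_iterate_next_le (registers q c M (t + 1) w i) r
    rw [← ih, hpos] at hle
    have hbits := lt_two_pow_bitLog ℓ
    have hndvd {k : ℕ} (hk : 0 < k) (hkℓ : k < ℓ + 1) : ¬ ℓ + 1 ∣ t + k := fun h =>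
      Nat.not_dvd_of_pos_of_lt hk hkℓ ((Nat.dvd_add_right ht).1 h)
    rw [Function.iterate_succ_apply', ← ih, ← add_assoc]
    refine registers_scan ?_ ?_ (by omega)
    · rw [add_assoc]
      exact hndvd (by omega) (by omega)
    · rw [add_assoc, add_assoc]
      exact hndvd (by omega) (by omega)

theorem registers_colour_phase (hM : Function.Injective M.ident) (hℓ : 1 ≤ ℓ) {s : ℕ} (hs : s ≤ q)
    (i : Fin Δ) : (registers q c M ((ℓ + 1) * (s + 1)) w i).colour =
      cvStep (registers q c M ((ℓ + 1) * s) w i).colour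
        (M.atNeighbour i (fun v => (registers q c M ((ℓ + 1) * s) v i).colour) w) := by
  set t := (ℓ + 1) * s with ht
  set a := (registers q c M t w i).colour with ha
  set p := M.atNeighbour i (fun v => (registers q c M t v i).colour) w
  obtain ⟨r, rfl⟩ : ∃ r, ℓ = r + 1 := ⟨ℓ - 1, by omega⟩
  have ha' : a < 2 ^ (r + 1) := registers_colour_lt i
  have hp' : p < 2 ^ (r + 1) :=
    KripkeModel.atNeighbour_lt (by positivity) (fun _ => registers_colour_lt i) i w
  have hcompare : registers q c M (t + 1) w i = ⟨a, a ^^^ p, 0⟩ :=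
    registers_compare hM hℓ (ht ▸ dvd_mul_right _ _) (by nlinarith) i
  have hscan : (registers q c M (t + 1 + r) w i).readOut = cvStep a p := by
    rw [registers_iterate_scan (ht ▸ dvd_mul_right _ _) (by rw [hcompare]) r.lt_succ_self, hcompare,
      ScanState.readOut_iterate_next ha' hp']
  have hend : (r + 1 + 1) * (s + 1) = t + 1 + r + 1 := by rw [ht]; ring
  rw [hend, registers_load (hend ▸ dvd_mul_right _ _), hscan, Nat.mod_eq_of_lt]
  exact (cvStep_lt ha' hp' hℓ).trans_le (two_mul_le_two_pow _)

theorem registers_colour_eq (hM : Function.Injective M.ident) (hℓ : 1 ≤ ℓ) {s : ℕ}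
    (hs : s ≤ q + 1) (w : M.W) (i : Fin Δ) :
    (registers q c M ((ℓ + 1) * s) w i).colour = M.colour i s w := by
  induction s generalizing w with
  | zero => rfl
  | succ s ih =>
    rw [registers_colour_phase hM hℓ (by omega), KripkeModel.colour, ih (by omega),
      funext (ih (by omega))]

variable (ℓ q) in
/-- The round in which all nodes output. -/
def outputRound : ℕ := (ℓ + 1) * (q + 1) + 1

/-- The colours of a node in the `Δ` pseudoforests after the last step. -/
noncomputable def finalColours (hℓ : 1 ≤ ℓ) (hc : 2 * bitBound ℓ q ≤ c) (w : M.W) :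
    Fin Δ → Fin c :=
  fun i => ⟨M.colour i (q + 1) w, (M.colour_succ_lt hℓ i q w).trans_le hc⟩

theorem finalColours_ne (hM : M.InClass Δ) (hirr : ∀ w, ¬ M.R w w) (hℓ : 1 ≤ ℓ)
    (hc : 2 * bitBound ℓ q ≤ c) {w v : M.W} (h : M.R w v) :
    (finalColours hℓ hc w : Fin Δ → Fin c) ≠ finalColours hℓ hc v := fun he => by
  obtain ⟨i, hi, hnbr⟩ := hM.exists_isNeighbour h
  exact M.colour_ne hM.2.1 hirr (q + 1) hnbr (congrArg Fin.val (congrFun he ⟨i, hi⟩))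

theorem config_out_outputRound (hM : Function.Injective M.ident) (hℓ : 1 ≤ ℓ)
    (hc : 2 * bitBound ℓ q ≤ c) {f : Fin Δ → Fin c} :
    (cvProgram ℓ Δ q c).config M (outputRound ℓ q) (out f) w ↔ f = finalColours hℓ hc w := by
  have hcol (i : Fin Δ) : register ((cvProgram ℓ Δ q c).config M ((ℓ + 1) * (q + 1))) (col i) w =
      M.colour i (q + 1) w := registers_colour_eq hM hℓ le_rfl w i
  simp only [outputRound, config_succ, cvClause, Clause.hotBody_nil, Sat, sat_allDone, sat_conj,
    sat_hasValue, hcol, mul_comm, le_refl, true_and, funext_iff, Fin.ext_iff, finalColours, eq_comm]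

theorem not_config_out (ht : t < outputRound ℓ q) (f : Fin Δ → Fin c) :
    ¬ (cvProgram ℓ Δ q c).config M t (out f) w := by
  rcases t with _ | t
  · simp [config_zero, cvTerminal]
  · have hlt : t < (q + 1) * (ℓ + 1) := by rw [mul_comm]; exact Nat.lt_of_succ_lt_succ ht
    simp only [config_succ, cvClause, Clause.hotBody_nil, Sat, sat_allDone, hlt.not_ge, false_and,
      not_false_iff]

theorem acceptsAt_cvProgram (hM : Function.Injective M.ident) (hℓ : 1 ≤ ℓ)
    (hc : 2 * bitBound ℓ q ≤ c) {n : ℕ} :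
    (cvProgram ℓ Δ q c).AcceptsAt M w n ↔ n = outputRound ℓ q :=
  Program.acceptsAt_iff_of_first
    ⟨_, mem_outs.2 ⟨_, rfl⟩, (config_out_outputRound hM hℓ hc).2 rfl⟩ fun m hm Y hY => by
      obtain ⟨f, rfl⟩ := mem_outs.1 hY
      exact not_config_out hm f

theorem properlyColours_cvProgram (hM : M.InClass Δ) (hirr : ∀ w, ¬ M.R w w) (hℓ : 1 ≤ ℓ)
    (hc : 2 * bitBound ℓ q ≤ c) : (cvProgram ℓ Δ q c).ProperlyColours M (c ^ Δ) := by
  rw [← card_outs (ℓ := ℓ) (q := q)]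
  refine Program.properlyColours_of_unique (Y := fun w => out (finalColours hℓ hc w))
    (fun w n => acceptsAt_cvProgram hM.2.1 hℓ hc) (fun w => mem_outs.2 ⟨_, rfl⟩) (fun w Z hZ => ?_)
    fun w v h he => finalColours_ne hM hirr hℓ hc h (out.inj he)
  obtain ⟨f, rfl⟩ := mem_outs.1 hZ
  rw [config_out_outputRound hM.2.1 hℓ hc, out.injEq]

theorem modalDepth_hotBody_pos {Y : CVHead ℓ Δ q c} {g : CVHead ℓ Δ q c → M.W → Prop} :
    0 < ((cvClause Y).hotBody M g w).modalDepth ↔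
      (∃ i j, Y = diff i j) ∧ g (tok 0) w ∧ ¬ allDone.Sat M g w := by
  rcases Y with _ | b | _ | _ | _ | _
  case ph =>
    cases b using Fin.cases <;>
      simp only [cvClause, Clause.hotBody_cons, Clause.hotBody_nil] <;> split_ifs <;> simp
  case tok => simp [cvClause]
  case out => simp [cvClause, modalDepth_conj_eq_zero]
  all_goals
    simp only [cvClause, Clause.hotBody_cons, Clause.hotBody_nil]
    split_ifs <;> simp_all [modalDepth_conj_eq_zero]

theorem commRounds_cvProgram (hΔ : 1 ≤ Δ) (hℓ : 1 ≤ ℓ) (M : KripkeModel ℓ) :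
    (cvProgram ℓ Δ q c).commRounds M = (fun s => (ℓ + 1) * s + 1) '' Set.Iio (q + 1) := by
  obtain ⟨w⟩ := M.nonempty
  have hhead : ∃ Y : CVHead ℓ Δ q c, ∃ i j, Y = diff i j := ⟨_, ⟨0, hΔ⟩, ⟨0, hℓ⟩, rfl⟩
  ext n
  constructor
  · rintro ⟨m, rfl, w, Y, hpos⟩
    obtain ⟨-, htok, hdone⟩ := modalDepth_hotBody_pos.1 hpos
    obtain ⟨s, rfl⟩ := config_tok_zero.1 htok
    rw [sat_allDone, mul_comm, not_le] at hdone
    exact ⟨s, Nat.lt_of_mul_lt_mul_left hdone, rfl⟩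
  · rintro ⟨s, hs, rfl⟩
    obtain ⟨Y, hY⟩ := hhead
    refine ⟨(ℓ + 1) * s, rfl, w, Y, modalDepth_hotBody_pos.2 ⟨hY, ?_, ?_⟩⟩
    · exact config_tok_zero.2 (dvd_mul_right _ _)
    · rw [sat_allDone, mul_comm, not_le]
      exact Nat.mul_lt_mul_of_pos_left hs ℓ.succ_pos

theorem encard_commRounds_cvProgram (hΔ : 1 ≤ Δ) (hℓ : 1 ≤ ℓ) (M : KripkeModel ℓ) :
    ((cvProgram ℓ Δ q c).commRounds M).encard = (q + 1 : ℕ) := by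
  have hinj : Function.Injective fun s => (ℓ + 1) * s + 1 := fun s s' h =>
    Nat.eq_of_mul_eq_mul_left ℓ.succ_pos (Nat.succ_injective h)
  rw [commRounds_cvProgram hΔ hℓ, hinj.encard_image, ← Finset.coe_Iio,
    Set.encard_coe_eq_coe_finsetCard, Nat.card_Iio]

theorem le_outputRound_of_mem_commRounds (hΔ : 1 ≤ Δ) (hℓ : 1 ≤ ℓ) {s : ℕ}
    (hs : s ∈ (cvProgram ℓ Δ q c).commRounds M) : s ≤ outputRound ℓ q := by
  rw [commRounds_cvProgram hΔ hℓ] at hs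
  obtain ⟨r, hr, rfl⟩ := hs
  exact Nat.succ_le_succ (Nat.mul_le_mul_left _ (le_of_lt hr))

end Run

theorem numHeads_cvProgram : (cvProgram ℓ Δ q c).numHeads =
    (ℓ + 1) + ((q + 1) + (Δ * ℓ + (Δ * ℓ + Δ * bitLog ℓ))) := by
  have hcard := sum_compl_outs (ℓ := ℓ) (Δ := Δ) (q := q) (c := c) fun _ => 1
  simpa [Program.numHeads, Program.appointed, cvProgram, ZMod.card] using hcard

/-- The number of symbols in the two clauses of a head. -/
def cvSize (Y : CVHead ℓ Δ q c) : ℕ := (1 + (cvTerminal Y).length) + (1 + (cvClause Y).length)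

theorem cvSize_tok_le (j : ZMod (ℓ + 1)) : cvSize (tok j : CVHead ℓ Δ q c) ≤ 5 := by
  by_cases h : j = 0 <;> simp [cvSize, cvTerminal, cvClause, Clause.length, bot, h]

theorem cvSize_ph_le (b : Fin (q + 1)) : cvSize (ph b : CVHead ℓ Δ q c) ≤ 7 := by
  cases b using Fin.cases <;> simp [cvSize, cvTerminal, cvClause, Clause.length, bot]

theorem cvSize_col_le (i : Fin Δ) (j : Fin ℓ) : cvSize (col i j : CVHead ℓ Δ q c) ≤ 16 := by
  have hfound := length_foundDigit_le (ℓ := ℓ) (q := q) (c := c) i j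
  have hcol := length_digit_le (ℓ := ℓ) (Δ := Δ) (col (ℓ := ℓ) (q := q) (c := c) i) (j + 1)
  have hdiff := length_digit_le (ℓ := ℓ) (Δ := Δ) (diff (ℓ := ℓ) (q := q) (c := c) i) 0
  simp only [cvSize, cvTerminal, cvClause, Clause.length, length, List.map_cons, List.map_nil,
    List.sum_cons, List.sum_nil]
  omega

theorem cvSize_diff_le (i : Fin Δ) (j : Fin ℓ) : cvSize (diff i j : CVHead ℓ Δ q c) ≤ 30 := by
  have hdiff := length_digit_le (ℓ := ℓ) (Δ := Δ) (diff (ℓ := ℓ) (q := q) (c := c) i)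
  have h0 := hdiff 0
  have hj := hdiff (j + 1)
  simp only [cvSize, cvTerminal, cvClause, Clause.length, length, bot, allDone, length_lxor,
    List.map_cons, List.map_nil, List.sum_cons, List.sum_nil]
  omega

theorem cvSize_cnt_le (i : Fin Δ) (k : Fin (bitLog ℓ)) :
    cvSize (cnt i k : CVHead ℓ Δ q c) ≤ 30 + 6 * bitLog ℓ := by
  have hdiff := length_digit_le (ℓ := ℓ) (Δ := Δ) (diff (ℓ := ℓ) (q := q) (c := c) i) 0
  have hconj := length_conj_le fun j : Fin k =>
    length_digit_le (ℓ := ℓ) (Δ := Δ) (cnt (ℓ := ℓ) (q := q) (c := c) i) j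
  simp only [cvSize, cvTerminal, cvClause, Clause.length, length, bot, length_lxor, List.map_cons,
    List.map_nil, List.sum_cons, List.sum_nil]
  omega

theorem size_cvProgram_le : (cvProgram ℓ Δ q c).size ≤
    (ℓ + 1) * 5 + ((q + 1) * 7 + (Δ * (ℓ * 16) + (Δ * (ℓ * 30) +
      Δ * (bitLog ℓ * (30 + 6 * bitLog ℓ))))) := by
  have hsize : (cvProgram ℓ Δ q c).size = ∑ Y ∈ (outs : Finset (CVHead ℓ Δ q c))ᶜ, cvSize Y := by
    simp only [Program.size, Program.appointed, cvProgram, Finset.union_self, cvSize]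
  rw [hsize, sum_compl_outs]
  have hsum {ι : Type} [Fintype ι] {f : ι → ℕ} {k : ℕ} (h : ∀ x, f x ≤ k) :
      ∑ x, f x ≤ Fintype.card ι * k :=
    Finset.sum_le_card_nsmul _ _ _ fun x _ => h x
  have htok := hsum (cvSize_tok_le (ℓ := ℓ) (Δ := Δ) (q := q) (c := c))
  have hph := hsum (cvSize_ph_le (ℓ := ℓ) (Δ := Δ) (q := q) (c := c))
  have hcol := hsum fun i => hsum (cvSize_col_le (ℓ := ℓ) (Δ := Δ) (q := q) (c := c) i)
  have hdiff := hsum fun i => hsum (cvSize_diff_le (ℓ := ℓ) (Δ := Δ) (q := q) (c := c) i)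
  have hcnt := hsum fun i => hsum (cvSize_cnt_le (ℓ := ℓ) (Δ := Δ) (q := q) (c := c) i)
  simp only [ZMod.card, Fintype.card_fin] at htok hph hcol hdiff hcnt
  exact add_le_add htok (add_le_add hph (add_le_add hcol (add_le_add hdiff hcnt)))


section Bounds

variable {n Δ : ℕ}

theorem logStar_add_four_le (hn : 1 ≤ n) : logStar n + 4 ≤ 6 * bitLog n := by
  have hstar := logStar_le_bitLog_add_one hn
  have hℓ : 1 ≤ bitLog n := Nat.succ_pos _
  omega

theorem numHeads_cvProgram_bitLog_le (hn : 1 ≤ n) (hΔ : 1 ≤ Δ) (c : ℕ) :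
    (cvProgram (bitLog n) Δ (logStar n + 3) c).numHeads ≤ 11 * (Δ * bitLog n) := by
  have hℓ : 1 ≤ bitLog n := Nat.succ_pos _
  have hstar := logStar_add_four_le hn
  have hΔℓ : bitLog n ≤ Δ * bitLog n := Nat.le_mul_of_pos_left _ hΔ
  have hcnt : Δ * bitLog (bitLog n) ≤ Δ * bitLog n := Nat.mul_le_mul_left Δ (bitLog_le_self hℓ)
  rw [numHeads_cvProgram]
  omega

theorem size_cvProgram_bitLog_le (hn : 1 ≤ n) (hΔ : 1 ≤ Δ) (c : ℕ) :
    (cvProgram (bitLog n) Δ (logStar n + 3) c).size ≤ 152 * (Δ * bitLog n) := by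
  have hℓ : 1 ≤ bitLog n := Nat.succ_pos _
  have hstar := logStar_add_four_le hn
  have hΔℓ : bitLog n ≤ Δ * bitLog n := Nat.le_mul_of_pos_left _ hΔ
  have hcnt : bitLog (bitLog n) * (30 + 6 * bitLog (bitLog n)) ≤ 54 * bitLog n := by
    nlinarith [bitLog_le_self hℓ, bitLog_sq_le hℓ]
  have hΔcnt := Nat.mul_le_mul_left Δ hcnt
  refine size_cvProgram_le.trans ?_
  linarith

theorem outputRound_bitLog_le (hn : 2 ≤ n) :
    outputRound (bitLog n) (logStar n + 3) ≤ 11 * (bitLog n * logStar n) := by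
  have hℓ : 1 ≤ bitLog n := Nat.succ_pos _
  have hstar := one_le_logStar hn
  unfold outputRound
  nlinarith

end Bounds

end MPMSC

open MPMSC in
theorem mainTheorem8_general :
    ∃ C : ℕ, ∀ n Δ : ℕ, 1 ≤ n → 1 ≤ Δ →
      ∃ (H : Type) (_ : Fintype H) (_ : LinearOrder H)
        (Λ : Program (bitLog n) Δ H),
        (Λ.attention = Λ.print ∧ Λ.appointed.card = 7 ^ Δ) ∧
        (∀ M : KripkeModel (bitLog n), M.InClass Δ → (∀ w, ¬ M.R w w) →
          Λ.ProperlyColours M (7 ^ Δ)) ∧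
        (Λ.numHeads ≤ C * (Δ * bitLog n) ∧ Λ.size ≤ C * (Δ * bitLog n)) ∧
        (2 ≤ n → ∀ M : KripkeModel (bitLog n), M.InClass Δ →
          ∀ (w : M.W) (r : ℕ), Λ.AcceptsAt M w r →
            r ≤ C * (bitLog n * logStar n)) ∧
        (∀ M : KripkeModel (bitLog n), M.InClass Δ →
          (Λ.commRounds M).encard = logStar n + 4 ∧
          ∀ (w : M.W) (r : ℕ), Λ.AcceptsAt M w r → ∀ s ∈ Λ.commRounds M, s ≤ r) := by
  refine ⟨152, fun n Δ hn hΔ => ?_⟩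
  have hℓ : 1 ≤ bitLog n := Nat.succ_pos _
  have hc : 2 * bitBound (bitLog n) (logStar n + 3) ≤ 7 := by
    have h3 : bitBound (bitLog n) (logStar n + 3) ≤ 3 := bitBound_bitLog_le_three hn (by omega)
    omega
  refine ⟨CVHead (bitLog n) Δ (logStar n + 3) 7, inferInstance, inferInstance,
    cvProgram _ _ _ _, ⟨rfl, ?_⟩, ?_, ⟨?_, ?_⟩, ?_, ?_⟩
  · exact (congrArg Finset.card (Finset.union_self _)).trans CVHead.card_outs
  · exact fun M hM hirr => properlyColours_cvProgram hM hirr hℓ hc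
  · exact (numHeads_cvProgram_bitLog_le hn hΔ 7).trans (Nat.mul_le_mul_right _ (by norm_num))
  · exact size_cvProgram_bitLog_le hn hΔ 7
  · intro hn2 M hM w r hr
    obtain rfl := (acceptsAt_cvProgram hM.2.1 hℓ hc).1 hr
    exact (outputRound_bitLog_le hn2).trans (Nat.mul_le_mul_right _ (by norm_num))
  · refine fun M hM => ⟨encard_commRounds_cvProgram hΔ hℓ M, fun w r hr s hs => ?_⟩
    obtain rfl := (acceptsAt_cvProgram hM.2.1 hℓ hc).1 hr
    exact le_outputRound_of_mem_commRounds hΔ hℓ hs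

theorem mainTheorem8 :
    ∃ C : ℕ, ∀ n Δ : ℕ, 1 ≤ n → 1 ≤ Δ →
      ∃ (H : Type) (_ : Fintype H) (_ : LinearOrder H)
        (Λ : MPMSC.Program (MPMSC.bitLog n) Δ H),
        -- the appointed predicates
        (Λ.attention = Λ.print ∧ Λ.appointed.card = 7 ^ Δ) ∧
        -- the colouring
        Λ.DefinesProperColouring (7 ^ Δ) ∧
        -- heads and size, ignoring appointed predicates
        (Λ.numHeads ≤ C * (Δ * MPMSC.bitLog n) ∧ Λ.size ≤ C * (Δ ^ 2 * MPMSC.bitLog n)) ∧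
        -- the number of iterations
        (2 ≤ n → ∀ M : MPMSC.KripkeModel (MPMSC.bitLog n), M.IsGraph Δ →
          ∀ (w : M.W) (r : ℕ), Λ.AcceptsAt M w r →
            r ≤ C * (MPMSC.bitLog n * MPMSC.bitLog (MPMSC.bitLog n) * MPMSC.logStar n)) ∧
        -- the global communication rounds, all of which precede every output
        (∀ M : MPMSC.KripkeModel (MPMSC.bitLog n), M.IsGraph Δ →
          (Λ.commRounds M).encard = MPMSC.logStar n + 4 ∧
          ∀ (w : M.W) (r : ℕ), Λ.AcceptsAt M w r → ∀ s ∈ Λ.commRounds M, s ≤ r) := by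
  obtain ⟨C, h⟩ := mainTheorem8_general
  refine ⟨C, fun n Δ hn hΔ => ?_⟩
  obtain ⟨H, hfin, hord, Λ, happ, hcol, ⟨hheads, hsize⟩, hround, hcomm⟩ := h n Δ hn hΔ
  have hΔsq : Δ * MPMSC.bitLog n ≤ Δ ^ 2 * MPMSC.bitLog n :=
    Nat.mul_le_mul_right _ (Nat.le_self_pow two_ne_zero Δ)
  have hlog : MPMSC.bitLog n ≤ MPMSC.bitLog n * MPMSC.bitLog (MPMSC.bitLog n) :=
    Nat.le_mul_of_pos_right _ (Nat.succ_pos _)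
  refine ⟨H, hfin, hord, Λ, happ, ?_, ⟨hheads, hsize.trans (Nat.mul_le_mul_left C hΔsq)⟩,
    fun hn2 M hM w r hr => (hround hn2 M hM.1 w r hr).trans ?_, fun M hM => hcomm M hM.1⟩
  · exact MPMSC.Program.definesProperColouring_of_properlyColours fun M hM => hcol M hM.1 hM.2.2
  · exact Nat.mul_le_mul_left C (Nat.mul_le_mul_right _ hlog)
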